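/- Let $k$ be an algebraically closed field of characteristic $0$ and let $(R,\mathfrak m,k)$ be a non-regular complete Noetherian local domain of dimension one which is a $k$-algebra with residue field $k$ (i.e. $k\to R/\mathfrak m$ is bijective). Then $R\cong P/I$ for some $P=k[[X_1,\dots,X_n]]$, $n\ge 2$, and $I\subseteq (X_1,\dots,X_n)^2$, and the integral closure $\overline R$ of $R$ in its fraction field is isomorphic to $k[[t]]$ as a $k$-algebra. Fix any presentation $R=P/I$ with $P=k[[X_1,\dots,X_n]]$ and any $k$-algebra identification $\overline R=k[[t]]$. Let $$\Omega_R=R^n\big/\big\langle(\partial f/\partial X_1,\dots,\partial f/\partial X_n) : f\in I\big\rangle$$ be the universally finite module of differentials of $R$ over $k$ (the cokernel of the Jacobian matrix of $I$). Let $\operatorname{tr}_R(\Omega_R)=\sum_{\alpha}\alpha(\Omega_R)$, where $\alpha$ ranges over $\operatorname{Hom}_R(\Omega_R,R)$, be its trace ideal. Let $v$ be the $t$-order on $k[[t]]$, with $v(0)=\infty$, and put $v(J)=\min\{v(y): y\in J\}$ for an ideal $J$ of $R$. Then $R$ is quasihomogeneous, i.e. there is a surjective $R$-linear map $\Omega_R\twoheadrightarrow\mathfrak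 m$, if and only if $$v(\operatorname{tr}_R(\Omega_R))=v(\mathfrak m).$$ -/

import Mathlib

noncomputable section

open scoped PowerSeries

/-- The trace ideal `tr_R(M) = ∑ α(M)`, where `α` ranges over `Hom_R(M, R)`. -/
def traceIdeal (R M : Type*) [CommRing R] [AddCommGroup M] [Module R M] : Ideal R :=
  ⨆ α : M →ₗ[R] R, LinearMap.range α

section Differentials

variable {k R : Type*} [Field k] [CommRing R] [Algebra k R] {n : ℕ}

/-- For a presentation `π : k⟦X₁, …, Xₙ⟧ → R` and a power series `f`, the row
`(∂f/∂X₁, …, ∂f/∂Xₙ)` of the Jacobian matrix, with entries in `R`. -/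
def jacobianRow (π : MvPowerSeries (Fin n) k →ₐ[k] R) (f : MvPowerSeries (Fin n) k) :
    Fin n → R :=
  fun i => π (MvPowerSeries.pderiv k i f)

/-- The `R`-submodule of `Rⁿ` spanned by the Jacobian rows of the elements of `I = ker π`.
It is the image of the Jacobian matrix of any system of generators of `I`, see
`jacobianSubmodule_eq_span`. -/
def jacobianSubmodule (π : MvPowerSeries (Fin n) k →ₐ[k] R) : Submodule R (Fin n → R) :=
  Submodule.span R (jacobianRow π '' (RingHom.ker π : Set (MvPowerSeries (Fin n) k)))

theorem jacobianSubmodule_eq_span (π : MvPowerSeries (Fin n) k →ₐ[k] R)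
    {ι : Type*} (f : ι → MvPowerSeries (Fin n) k)
    (hf : Ideal.span (Set.range f) = RingHom.ker π) :
    jacobianSubmodule π = Submodule.span R (Set.range fun j => jacobianRow π (f j)) := by
  have hmem : ∀ g ∈ Ideal.span (Set.range f), π g = 0 := fun g hg => by
    rw [hf] at hg
    exact hg
  apply le_antisymm
  · refine Submodule.span_le.2 ?_
    rintro _ ⟨g, hg, rfl⟩
    have hg' : g ∈ Ideal.span (Set.range f) := by
      rw [hf]
      exact hg
    refine Submodule.span_induction (p := fun g _ => jacobianRow π g ∈
      Submodule.span R (Set.range fun j => jacobianRow π (f j))) ?_ ?_ ?_ ?_ hg'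
    · rintro _ ⟨j, rfl⟩
      exact Submodule.subset_span ⟨j, rfl⟩
    · have : jacobianRow π 0 = 0 := by
        ext i
        simp [jacobianRow]
      rw [this]
      exact Submodule.zero_mem _
    · intro a b _ _ ha hb
      have : jacobianRow π (a + b) = jacobianRow π a + jacobianRow π b := by
        ext i
        simp [jacobianRow]
      rw [this]
      exact Submodule.add_mem _ ha hb
    · intro a b hb hb'
      have : jacobianRow π (a • b) = π a • jacobianRow π b := by
        ext i
        simp [jacobianRow, hmem b hb]
      rw [this]
      exact Submodule.smul_mem _ _ hb'
  · refine Submodule.span_mono ?_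
    rintro _ ⟨j, rfl⟩
    refine ⟨f j, ?_, rfl⟩
    exact hmem _ (Ideal.subset_span ⟨j, rfl⟩)

/-- The universally finite module of differentials `Ω_R` over `k` of `R = k⟦X₁, …, Xₙ⟧ / I`,
`I = ker π`: the cokernel of the Jacobian matrix of `I`. -/
abbrev UniversallyFiniteDifferentials (π : MvPowerSeries (Fin n) k →ₐ[k] R) : Type _ :=
  (Fin n → R) ⧸ jacobianSubmodule π

/-- `R` is quasihomogeneous: there is an `R`-linear surjection `Ω_R ↠ 𝔪`. -/
def IsQuasihomogeneous [IsLocalRing R] (π : MvPowerSeries (Fin n) k →ₐ[k] R) : Prop :=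
  ∃ φ : UniversallyFiniteDifferentials π →ₗ[R] IsLocalRing.maximalIdeal R,
    Function.Surjective φ

end Differentials

/-- The normalization of a domain `R`: its integral closure in its field of fractions. -/
abbrev Normalization (R : Type*) [CommRing R] [IsDomain R] :=
  integralClosure R (FractionRing R)

/-- The order valuation `v` on `R`, read off from an identification `e` of the normalization of
`R` with `k⟦t⟧`; `v(0) = ∞`. -/
def orderValuation {k R : Type*} [Field k] [CommRing R] [IsDomain R] [Algebra k R]
    (e : Normalization R ≃ₐ[k] k⟦X⟧) (y : R) : ℕ∞ :=
  (e (algebraMap R (Normalization R) y)).order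

/-- `v(J) = min {v(y) | y ∈ J}` for an ideal `J` of `R`. -/
def idealValuation {k R : Type*} [Field k] [CommRing R] [IsDomain R] [Algebra k R]
    (e : Normalization R ≃ₐ[k] k⟦X⟧) (J : Ideal R) : ℕ∞ :=
  sInf (orderValuation e '' (J : Set R))

end

/-!
# Quasihomogeneity of a curve branch and the order of the trace ideal of its differentials

Write `S = k⟦t⟧` for the normalization of `R`, and `v` for the `t`-order.

**The normalization.** A nonzero `x ∈ 𝔪` makes `R` a finite extension of `k⟦x⟧`, by completeness and
because `R / xR` is finite-dimensional over `k` (`PowerSeries.finite_of_finite_quotient`). In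
characteristic zero the extension of fraction fields is separable, so the normalization is a
Dedekind domain that is finite over `k⟦x⟧`. It is `x`-adically complete, so idempotents lift from
its Artinian quotient modulo `x`; being a domain it is local
(`IsLocalRing.of_henselianRing_of_isArtinianRing`), hence a complete discrete valuation ring with
residue field `k`, which is `k⟦t⟧`. As `S` is finite over `R`, some `t ^ c S` lies in `R`.

**Derivations.** Linear forms `α : Ω_R → R` are derivations `D` of `R`, and the image of `α` is the
ideal generated by the values of `D` on the variables (`exists_derivation_of_differentials`). A
derivation into a torsion-free separated module that kills `x` kills `k⟦x⟧`, and then everything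
algebraic over it. So every `D` is proportional to `d/dt` over the fraction field
(`Derivation.mul_derivative_eq_mul_derivative`), and `v(D y) - v(y)` is the same for all
`y ∈ 𝔪 \ {0}`.

**Quasihomogeneous implies equality.** A surjection `Ω_R → 𝔪` shows `𝔪 ⊆ tr(Ω_R)`. If the trace were
not `𝔪`, some `D w` with `w ∈ 𝔪` would be a unit. Then `D` lowers orders by `v(w)`, so `v(w)` divides
every element of the value semigroup. The semigroup contains all large integers, so `v(w) = 1`,
which forces `R = S`, contrary to `R` being non-regular.

**Equality implies quasihomogeneous.** If `v(tr(Ω_R)) = v(𝔪)`, some `D` and some variable `x` satisfy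
`v(D x) = v(𝔪)`, and comparing with an element of least order gives `v(x) = v(𝔪)` too. So `D`
preserves orders on `𝔪`. It maps `t ^ c S` onto itself by integration, and leading terms can be
cancelled one at a time below `c`, so `D` maps `𝔪` onto `𝔪`
(`Derivation.exists_eq_of_order_eq`). The image of the corresponding `α` lies in `𝔪` and contains
`D 𝔪 = 𝔪`.
-/

open scoped PowerSeries

/-! ### Power series rings -/

namespace MvPowerSeries

variable {σ k : Type*} [CommRing k]

theorem le_order_of_mem_span_X_pow (n : ℕ) {f : MvPowerSeries σ k}
    (hf : f ∈ Ideal.span (Set.range (X : σ → MvPowerSeries σ k)) ^ n) :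
    (n : ℕ∞) ≤ f.order := by
  induction n generalizing f with
  | zero => simp
  | succ n ih =>
    rw [pow_succ] at hf
    refine Submodule.mul_induction_on hf (fun a ha b hb => ?_) (fun a b ha hb => ?_)
    · refine le_trans ?_ le_order_mul
      push_cast
      refine add_le_add (ih ha) ?_
      have : Ideal.span (Set.range (X : σ → MvPowerSeries σ k)) ≤
          RingHom.ker (constantCoeff (σ := σ) (R := k)) := by
        rw [Ideal.span_le]
        rintro _ ⟨i, rfl⟩
        simp
      exact one_le_order_iff_constCoeff_eq_zero.2 (this hb)
    · exact le_trans (le_min ha hb) min_order_le_add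

variable [Finite σ]

theorem sub_truncTotal_mem (n : ℕ) (f : MvPowerSeries σ k) :
    f - ((truncTotal n f : MvPolynomial σ k) : MvPowerSeries σ k) ∈
      Ideal.span (Set.range (X : σ → MvPowerSeries σ k)) ^ n := by
  set I := Ideal.span (Set.range (X : σ → MvPowerSeries σ k)) with hI
  have hmap : (MvPolynomial.idealOfVars σ k).map
      (MvPolynomial.coeToMvPowerSeries.ringHom (σ := σ) (R := k)) = I := by
    rw [MvPolynomial.idealOfVars, Ideal.map_span, ← Set.range_comp, hI]
    congr 2
    ext1 i
    simp
  have hc : ∀ {m n : ℕ}, m ≤ n → ((truncTotal m f : MvPolynomial σ k) : MvPowerSeries σ k) ≡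
      (truncTotal n f : MvPolynomial σ k) [SMOD (I ^ m • ⊤ : Ideal (MvPowerSeries σ k))] := by
    intro m n hmn
    rw [SModEq.sub_mem, smul_eq_mul, Ideal.mul_top, ← hmap, ← Ideal.map_pow]
    have := Ideal.mem_map_of_mem (MvPolynomial.coeToMvPowerSeries.ringHom (σ := σ) (R := k))
      (truncTotal_sub_truncTotal_mem_pow_idealOfVars le_rfl hmn f)
    rw [map_sub] at this
    exact this
  obtain ⟨L, hL⟩ := IsPrecomplete.prec (I := I) (M := MvPowerSeries σ k) inferInstance hc
  have hL' : ∀ m, L - ((truncTotal m f : MvPolynomial σ k) : MvPowerSeries σ k) ∈ I ^ m := by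
    intro m
    have := (hL m).symm
    rwa [SModEq.sub_mem, smul_eq_mul, Ideal.mul_top] at this
  have : f = L := by
    ext d
    have h1 := le_order_of_mem_span_X_pow _ (hL' (d.degree + 1))
    have h2 : coeff d (L - ((truncTotal (d.degree + 1) f : MvPolynomial σ k) : MvPowerSeries σ k)) = 0 :=
      coeff_of_lt_order (lt_of_lt_of_le (by exact_mod_cast Nat.lt_succ_self _) h1)
    rw [map_sub, MvPolynomial.coeff_coe, coeff_truncTotal _ (Nat.lt_succ_self _),
      sub_eq_zero] at h2
    exact h2.symm
  rw [this] at hL' ⊢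
  exact hL' n

/-- Evaluation of power series at elements of an ideal for which the target is complete. -/
theorem exists_algHom_X_eq {S : Type*} [CommRing S] [Algebra k S] (I : Ideal S)
    [IsAdicComplete I S] (x : σ → S) (hx : ∀ i, x i ∈ I) :
    ∃ φ : MvPowerSeries σ k →ₐ[k] S, ∀ i, φ (X i) = x i := by
  have hle : ∀ n : ℕ, MvPolynomial.idealOfVars σ k ^ n ≤
      (I ^ n).comap (MvPolynomial.aeval x : MvPolynomial σ k →ₐ[k] S) := by
    intro n
    rw [← Ideal.map_le_iff_le_comap, Ideal.map_pow]
    refine Ideal.pow_right_mono ?_ n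
    rw [MvPolynomial.idealOfVars, Ideal.map_span, Ideal.span_le]
    rintro _ ⟨_, ⟨i, rfl⟩, rfl⟩
    simpa using hx i
  let f : (n : ℕ) → MvPowerSeries σ k →ₐ[k] S ⧸ I ^ n := fun n =>
    (Ideal.quotientMapₐ (I ^ n) (MvPolynomial.aeval x) (hle n)).comp
      ((truncTotalAlgHom σ k n).restrictScalars k)
  have hf' : ∀ n p, f n p = Ideal.Quotient.mk (I ^ n) (MvPolynomial.aeval x (truncTotal n p)) :=
    fun n p => rfl
  have hf : ∀ {m n : ℕ} (hle : m ≤ n),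
      (Ideal.Quotient.factorₐ k (Ideal.pow_le_pow_right hle)).comp (f n) = f m := by
    intro m n hmn
    ext p
    rw [AlgHom.comp_apply, hf', hf', Ideal.Quotient.factorₐ_apply_mk, Ideal.Quotient.eq, ← map_sub]
    exact hle m (truncTotal_sub_truncTotal_mem_pow_idealOfVars hmn le_rfl p)
  refine ⟨IsAdicComplete.liftAlgHom I f hf, fun i => ?_⟩
  refine (IsHausdorff.eq_iff_smodEq (I := I)).2 fun n => ?_
  rw [SModEq.sub_mem, smul_eq_mul, Ideal.mul_top, ← Ideal.Quotient.eq,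
    IsAdicComplete.mk_liftAlgHom I f hf, hf', Ideal.Quotient.eq]
  have : truncTotal n (X i) - (MvPolynomial.X i : MvPolynomial σ k) ∈
      MvPolynomial.idealOfVars σ k ^ n := by
    refine (MvPolynomial.mem_pow_idealOfVars_iff' ..).mpr fun d hd => ?_
    rw [MvPolynomial.coeff_sub, coeff_truncTotal _ hd, ← MvPolynomial.coe_X,
      MvPolynomial.coeff_coe, sub_self]
  simpa using hle n this

/-- A derivation into a module that is separated for the `(X)`-adic topology is determined by the
images of the variables. -/
theorem derivation_eq_zero {M : Type*} [AddCommGroup M] [Module k M]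
    [Module (MvPowerSeries σ k) M]
    [IsHausdorff (Ideal.span (Set.range (X : σ → MvPowerSeries σ k))) M]
    (D : Derivation k (MvPowerSeries σ k) M) (hD : ∀ i, D (X i) = 0) : D = 0 := by
  set I := Ideal.span (Set.range (X : σ → MvPowerSeries σ k)) with hI
  have hpow : ∀ n : ℕ, ∀ f ∈ I ^ (n + 1), D f ∈ (I ^ n • ⊤ : Submodule (MvPowerSeries σ k) M) := by
    intro n
    induction n with
    | zero => simp
    | succ n ih =>
      intro f hf
      rw [pow_succ] at hf
      refine Submodule.mul_induction_on hf (fun a ha b hb => ?_) (fun a b ha hb => ?_)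
      · rw [D.leibniz]
        refine add_mem (Submodule.smul_mem_smul ha trivial) ?_
        rw [pow_succ', Submodule.mul_smul]
        exact Submodule.smul_mem_smul hb (ih a ha)
      · rw [map_add]
        exact add_mem ha hb
  have hpoly : ∀ p : MvPolynomial σ k, D (p : MvPowerSeries σ k) = 0 := by
    intro p
    induction p using MvPolynomial.induction_on with
    | C a =>
      rw [MvPolynomial.coe_C]
      exact D.map_algebraMap a
    | add p q hp hq => rw [MvPolynomial.coe_add, map_add, hp, hq, add_zero]
    | mul_X p i hp => rw [MvPolynomial.coe_mul, D.leibniz, hp, MvPolynomial.coe_X, hD]; simp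
  ext f
  refine (IsHausdorff.eq_iff_smodEq (I := I)).2 fun n => ?_
  rw [Derivation.zero_apply, SModEq.zero]
  have := hpow n _ (sub_truncTotal_mem (n + 1) f)
  rwa [map_sub, hpoly, sub_zero] at this

end MvPowerSeries

namespace PowerSeries

variable {k : Type*} [CommRing k]

theorem exists_algHom_X_eq {S : Type*} [CommRing S] [Algebra k S] (I : Ideal S)
    [IsAdicComplete I S] (x : S) (hx : x ∈ I) :
    ∃ φ : k⟦X⟧ →ₐ[k] S, φ X = x := by
  obtain ⟨φ, hφ⟩ := MvPowerSeries.exists_algHom_X_eq (σ := Unit) (k := k) I (fun _ => x)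
    fun _ => hx
  exact ⟨φ, hφ ()⟩

theorem derivation_eq_zero {M : Type*} [AddCommGroup M] [Module k M] [Module k⟦X⟧ M]
    [h : IsHausdorff (Ideal.span {(X : k⟦X⟧)}) M]
    (D : Derivation k k⟦X⟧ M) (hD : D X = 0) : D = 0 := by
  have : IsHausdorff (Ideal.span (Set.range (MvPowerSeries.X : Unit → MvPowerSeries Unit k))) M := by
    rwa [Set.range_unique]
  exact MvPowerSeries.derivation_eq_zero (σ := Unit) (k := k) D fun _ => hD

end PowerSeries

/-! ### Orders of one-variable power series -/

namespace PowerSeries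

variable {k : Type*} [Field k]

theorem dvd_of_order_le_order {f g : k⟦X⟧} (hf : f ≠ 0) (h : f.order ≤ g.order) : f ∣ g := by
  have h1 : X ^ f.order.toNat ∣ g := by
    rw [X_pow_dvd_iff]
    intro m hm
    refine coeff_of_lt_order _ (lt_of_lt_of_le ?_ h)
    rw [← coe_toNat_order hf]
    exact_mod_cast hm
  have h2 : Associated (X ^ f.order.toNat) f := by
    exact ⟨Unit_of_divided_by_X_pow_order f, by
      rw [Unit_of_divided_by_X_pow_order_nonzero hf, X_pow_order_mul_divXPowOrder]⟩
  exact h2.symm.dvd.trans h1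

theorem order_derivative_add_one [CharZero k] {f : k⟦X⟧} (hf : constantCoeff f = 0) :
    (d⁄dX k f).order + 1 = f.order := by
  by_cases h0 : f = 0
  · simp [h0]
  obtain ⟨n, hn⟩ : ∃ n : ℕ, f.order = n := ⟨_, (coe_toNat_order h0).symm⟩
  obtain ⟨h1, h2⟩ := order_eq_nat.1 hn
  obtain _ | n := n
  · exact absurd (by simpa using hf) h1
  have : (d⁄dX k f).order = n := by
    rw [order_eq_nat]
    refine ⟨?_, fun i hi => ?_⟩
    · rw [coeff_derivative]
      exact mul_ne_zero h1 (by exact_mod_cast Nat.succ_ne_zero n)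
    · rw [coeff_derivative, h2 _ (by omega), zero_mul]
  rw [this, hn]
  push_cast
  rfl

theorem exists_derivative_eq [CharZero k] (g : k⟦X⟧) :
    ∃ f : k⟦X⟧, constantCoeff f = 0 ∧ d⁄dX k f = g := by
  refine ⟨mk fun n => coeff (n - 1) g / n, ?_, ?_⟩
  · rw [← coeff_zero_eq_constantCoeff_apply, coeff_mk, Nat.cast_zero, div_zero]
  ext n
  rw [coeff_derivative, coeff_mk, Nat.add_sub_cancel]
  have : (n : k) + 1 ≠ 0 := by exact_mod_cast Nat.succ_ne_zero n
  push_cast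
  field_simp

/-- A subspace `P` of `M` that contains the elements of `M` of high order is all of `M` as soon as it
attains every order that occurs in `M`, since leading terms can be cancelled one at a time. -/
theorem le_of_order_eq (M P : Submodule k k⟦X⟧) (hP : P ≤ M) (c : ℕ)
    (hc : ∀ f ∈ M, (c : ℕ∞) ≤ f.order → f ∈ P)
    (h : ∀ f ∈ M, f ≠ 0 → ∃ g ∈ P, g.order = f.order) : M ≤ P := by
  have key : ∀ j n : ℕ, c ≤ n + j → ∀ f ∈ M, (n : ℕ∞) ≤ f.order → f ∈ P := by
    intro j
    induction j with
    | zero =>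
      intro n hn f hf hfn
      exact hc f hf (le_trans (by exact_mod_cast hn) hfn)
    | succ j ih =>
      intro n hn f hf hfn
      by_cases h0 : f = 0
      · rw [h0]; exact P.zero_mem
      by_cases hlt : (n : ℕ∞) < f.order
      · refine ih (n + 1) (by omega) f hf ?_
        push_cast
        exact Order.add_one_le_of_lt hlt
      have hfo : f.order = n := le_antisymm (not_lt.1 hlt) hfn
      obtain ⟨g, hg, hgo⟩ := h f hf h0
      rw [hfo] at hgo
      obtain ⟨hf1, hf2⟩ := order_eq_nat.1 hfo
      obtain ⟨hg1, hg2⟩ := order_eq_nat.1 hgo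
      set a := coeff n f / coeff n g
      have hmem : f - a • g ∈ P := by
        refine ih (n + 1) (by omega) _ (sub_mem hf (M.smul_mem _ (hP hg))) ?_
        refine nat_le_order _ _ fun i hi => ?_
        rw [map_sub, coeff_smul, smul_eq_mul]
        rcases Nat.lt_succ_iff_lt_or_eq.1 hi with hi | rfl
        · rw [hf2 i hi, hg2 i hi, mul_zero, sub_zero]
        · rw [div_mul_cancel₀ _ hg1, sub_self]
      simpa using add_mem hmem (P.smul_mem a hg)
  intro f hf
  exact key c 0 (by omega) f hf (by simp)

end PowerSeries

/-! ### Derivations of a one-dimensional domain -/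

/-- In characteristic zero, a derivation that kills `x` kills everything integral over `k⟦x⟧`. -/
theorem Derivation.eq_zero_of_isIntegral {k R S : Type*} [Field k] [CharZero k] [CommRing R]
    [IsDomain R] [Algebra k R] [CommRing S] [IsDomain S] [Algebra k S] [Algebra R S]
    [IsScalarTower k R S] (φ : k⟦X⟧ →ₐ[k] R) (hφ : φ.toRingHom.IsIntegral)
    (hφi : Function.Injective φ) (hRS : Function.Injective (algebraMap R S))
    (hS : ∀ s : S, (∀ n : ℕ, algebraMap R S (φ PowerSeries.X) ^ n ∣ s) → s = 0)
    (δ : Derivation k R S) (hδ : δ (φ PowerSeries.X) = 0) : δ = 0 := by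
  let _ : Algebra k⟦X⟧ R := φ.toRingHom.toAlgebra
  let _ : Algebra k⟦X⟧ S := ((algebraMap R S).comp φ.toRingHom).toAlgebra
  have : IsScalarTower k⟦X⟧ R S := IsScalarTower.of_algebraMap_eq fun _ => rfl
  have : IsScalarTower k k⟦X⟧ R := IsScalarTower.of_algebraMap_eq fun a => (φ.commutes a).symm
  have : CharZero k⟦X⟧ := charZero_of_injective_algebraMap (algebraMap k k⟦X⟧).injective
  have : Module.IsTorsionFree k⟦X⟧ R := by
    rw [Module.isTorsionFree_iff_algebraMap_injective]
    exact hφi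
  have : IsHausdorff (Ideal.span {(PowerSeries.X : k⟦X⟧)}) S := ⟨fun s hs => hS s fun n => by
    have := hs n
    rw [SModEq.zero, Ideal.span_singleton_pow, Submodule.ideal_span_singleton_smul,
      Submodule.mem_smul_pointwise_iff_exists] at this
    obtain ⟨u, -, rfl⟩ := this
    rw [Algebra.smul_def, map_pow]
    exact dvd_mul_right _ _⟩
  have h0 : δ.compAlgebraMap k⟦X⟧ = 0 := PowerSeries.derivation_eq_zero _ hδ
  have h1 : ∀ f : k⟦X⟧, δ (algebraMap k⟦X⟧ R f) = 0 := fun f => DFunLike.congr_fun h0 f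
  let δ' : Derivation k⟦X⟧ R S := Derivation.mk'
    { toFun := δ
      map_add' := map_add δ
      map_smul' := fun f r => by
        rw [Algebra.smul_def, δ.leibniz, h1, smul_zero, add_zero, RingHom.id_apply,
          algebraMap_smul] } δ.leibniz
  ext b
  have hb : IsIntegral k⟦X⟧ b := hφ b
  set p := minpoly k⟦X⟧ b with hp
  have h2 : Polynomial.aeval b (Polynomial.derivative p) • δ' b = 0 := by
    rw [← Derivation.map_aeval, minpoly.aeval, map_zero]
  have h3 : Polynomial.aeval b (Polynomial.derivative p) ≠ 0 := by
    intro h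
    have hdeg : 0 < p.natDegree := minpoly.natDegree_pos hb
    have hne : Polynomial.derivative p ≠ 0 := by
      intro h'
      rw [Polynomial.derivative_eq_zero] at h'
      omega
    exact (minpoly.IsIntegrallyClosed.degree_le_of_ne_zero hne h).not_gt
      (Polynomial.degree_derivative_lt (minpoly.ne_zero hb))
  rw [Algebra.smul_def, mul_eq_zero, map_eq_zero_iff _ hRS] at h2
  exact h2.resolve_left h3

section Branch

variable {k R : Type*} [Field k] [CommRing R] [Algebra k R]

/-- All derivations of a one-dimensional domain `R ⊆ k⟦t⟧` are proportional to `d/dt`. -/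
theorem Derivation.mul_derivative_eq_mul_derivative [CharZero k] [IsDomain R]
    (ι : R →ₐ[k] k⟦X⟧) (hι : Function.Injective ι)
    (φ : k⟦X⟧ →ₐ[k] R) (hφ : φ.toRingHom.IsIntegral) (hφi : Function.Injective φ)
    (hφX : PowerSeries.constantCoeff (ι (φ PowerSeries.X)) = 0)
    (D : Derivation k R R) (y z : R) :
    ι (D y) * PowerSeries.derivative k (ι z) = ι (D z) * PowerSeries.derivative k (ι y) := by
  let _ : Algebra R k⟦X⟧ := ι.toRingHom.toAlgebra
  have : IsScalarTower k R k⟦X⟧ := IsScalarTower.of_algebraMap_eq fun a => (ι.commutes a).symm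
  set x := φ PowerSeries.X with hx
  have hx0 : ι x ≠ 0 := by
    rw [Ne, map_eq_zero_iff _ hι, hx, map_eq_zero_iff _ hφi]
    exact PowerSeries.X_ne_zero
  have hdx : PowerSeries.derivative k (ι x) ≠ 0 := by
    intro h
    have := PowerSeries.order_derivative_add_one hφX
    rw [h, PowerSeries.order_zero, top_add, eq_comm, PowerSeries.order_eq_top] at this
    exact hx0 this
  let δ : Derivation k R k⟦X⟧ :=
    PowerSeries.derivative k (ι x) • (Algebra.linearMap R k⟦X⟧).compDer D -
      ι (D x) • (PowerSeries.derivative k).compAlgebraMap R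
  have hδ : ∀ r, δ r = PowerSeries.derivative k (ι x) * ι (D r) -
      ι (D x) * PowerSeries.derivative k (ι r) := fun r => rfl
  have h0 : δ = 0 := by
    refine Derivation.eq_zero_of_isIntegral φ hφ hφi hι (fun s hs => ?_) δ ?_
    · rw [← PowerSeries.order_eq_top, ENat.eq_top_iff_forall_ge]
      intro n
      obtain ⟨u, rfl⟩ := hs n
      rw [PowerSeries.order_mul]
      exact le_add_right (PowerSeries.le_order_pow_of_constantCoeff_eq_zero n hφX)
    · rw [hδ, ← hx, mul_comm, sub_self]
  have h1 : ∀ r, PowerSeries.derivative k (ι x) * ι (D r) =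
      ι (D x) * PowerSeries.derivative k (ι r) := fun r => by
    rw [← sub_eq_zero, ← hδ, h0, Derivation.zero_apply]
  refine mul_left_cancel₀ hdx ?_
  linear_combination PowerSeries.derivative k (ι z) * h1 y - PowerSeries.derivative k (ι y) * h1 z

theorem Derivation.order_add_order_eq [CharZero k] (ι : R →ₐ[k] k⟦X⟧) {D : Derivation k R R}
    (hD : ∀ y z, ι (D y) * PowerSeries.derivative k (ι z) =
      ι (D z) * PowerSeries.derivative k (ι y)) {y z : R}
    (hy : PowerSeries.constantCoeff (ι y) = 0) (hz : PowerSeries.constantCoeff (ι z) = 0) :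
    (ι (D y)).order + (ι z).order = (ι (D z)).order + (ι y).order := by
  have h := congrArg PowerSeries.order (hD y z)
  rw [PowerSeries.order_mul, PowerSeries.order_mul] at h
  rw [← PowerSeries.order_derivative_add_one hy, ← PowerSeries.order_derivative_add_one hz,
    ← add_assoc, ← add_assoc, h]

/-- If `D y` is a unit, subtract the constant term from `y` to get `w`. Then `D` lowers orders by the
order of `w`, so this order divides every order that occurs, and these include all large integers.
-/
theorem exists_order_eq_one_of_isUnit_derivation [CharZero k] (ι : R →ₐ[k] k⟦X⟧)
    (hι : Function.Injective ι) {c : ℕ} (hc : ∀ f : k⟦X⟧, (c : ℕ∞) ≤ f.order → f ∈ Set.range ι)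
    {D : Derivation k R R}
    (hD : ∀ y z, ι (D y) * PowerSeries.derivative k (ι z) =
      ι (D z) * PowerSeries.derivative k (ι y)) {y : R} (hy : IsUnit (D y)) :
    ∃ w : R, (ι w).order = 1 := by
  let a : k := PowerSeries.constantCoeff (ι y)
  set w := y - algebraMap k R a with hw
  have hw0 : PowerSeries.constantCoeff (ι w) = 0 := by
    rw [hw, map_sub, ι.commutes, map_sub, PowerSeries.algebraMap_apply]
    simp [a]
  have hDw : (ι (D w)).order = 0 := by
    rw [hw, map_sub, D.map_algebraMap, sub_zero]
    exact PowerSeries.order_zero_of_unit (hy.map ι)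
  have hwne : ι w ≠ 0 := by
    intro h
    rw [map_eq_zero_iff _ hι] at h
    rw [h, map_zero, map_zero, PowerSeries.order_zero] at hDw
    exact ENat.top_ne_zero hDw
  obtain ⟨e, he⟩ : ∃ e : ℕ, (ι w).order = e := ⟨_, (PowerSeries.coe_toNat_order hwne).symm⟩
  have he0 : e ≠ 0 := by
    rintro rfl
    exact PowerSeries.order_ne_zero_iff_constCoeff_eq_zero.2 hw0 (by simpa using he)
  -- subtracting `e` does not leave the value semigroup
  have hdvd : ∀ n : ℕ, ∀ z : R, (ι z).order = n → e ∣ n := by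
    intro n
    induction n using Nat.strong_induction_on with
    | _ n ih =>
      intro z hz
      obtain rfl | hn := Nat.eq_zero_or_pos n
      · exact dvd_zero e
      have hz0 : PowerSeries.constantCoeff (ι z) = 0 := by
        rw [← PowerSeries.order_ne_zero_iff_constCoeff_eq_zero, hz]
        exact_mod_cast hn.ne'
      have h := Derivation.order_add_order_eq ι hD hw0 hz0
      rw [hDw, zero_add, hz, he] at h
      obtain ⟨m, hm⟩ : ∃ m : ℕ, (ι (D z)).order = m := by
        refine ⟨_, (ENat.natCast_toNat fun ht => ?_).symm⟩
        rw [ht, top_add] at h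
        exact ENat.natCast_ne_top n h
      rw [hm] at h
      have h' : n = m + e := by exact_mod_cast h
      rw [h']
      exact (ih m (by omega) (D z) hm).add (dvd_refl e)
  obtain ⟨r, hr⟩ := hc (PowerSeries.X ^ c) (by rw [PowerSeries.order_X_pow])
  obtain ⟨s, hs⟩ := hc (PowerSeries.X ^ (c + 1)) (by
    rw [PowerSeries.order_X_pow]; exact_mod_cast Nat.le_succ c)
  have h1 := hdvd c r (by rw [hr, PowerSeries.order_X_pow])
  have h2 := hdvd (c + 1) s (by rw [hs, PowerSeries.order_X_pow])
  have : e = 1 := Nat.dvd_one.1 ((Nat.dvd_add_right h1).1 h2)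
  exact ⟨w, by rw [he, this]; rfl⟩

/-- A derivation that preserves orders on the maximal ideal maps it onto itself. -/
theorem Derivation.exists_eq_of_order_eq [CharZero k] (ι : R →ₐ[k] k⟦X⟧)
    (hι : Function.Injective ι)
    {c : ℕ} (hc : ∀ f : k⟦X⟧, (c : ℕ∞) ≤ f.order → f ∈ Set.range ι)
    {D : Derivation k R R}
    (hD : ∀ y z, ι (D y) * PowerSeries.derivative k (ι z) =
      ι (D z) * PowerSeries.derivative k (ι y)) {x : R} (hx : ι x ≠ 0)
    (hx0 : PowerSeries.constantCoeff (ι x) = 0) (hDx : (ι (D x)).order = (ι x).order)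
    {z : R} (hz : PowerSeries.constantCoeff (ι z) = 0) : ∃ y : R, D y = z := by
  have hord : ∀ z, PowerSeries.constantCoeff (ι z) = 0 → (ι (D z)).order = (ι z).order := by
    intro z hz
    have h := Derivation.order_add_order_eq ι hD hx0 hz
    rw [hDx, add_comm] at h
    refine (WithTop.add_right_cancel (fun ht => hx (PowerSeries.order_eq_top.1 ht)) h).symm
  let m : Submodule k R := LinearMap.ker ((PowerSeries.coeff (R := k) 0) ∘ₗ ι.toLinearMap)
  have hm : ∀ r, r ∈ m ↔ PowerSeries.constantCoeff (ι r) = 0 := fun r => by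
    rw [← PowerSeries.coeff_zero_eq_constantCoeff_apply]
    rfl
  have hDm : ∀ r ∈ m, D r ∈ m := fun r hr => by
    rw [hm, ← PowerSeries.order_ne_zero_iff_constCoeff_eq_zero] at hr ⊢
    rwa [hord r ((hm r).1 (by rwa [hm, ← PowerSeries.order_ne_zero_iff_constCoeff_eq_zero]))]
  have key : m.map ι.toLinearMap ≤ (m.map (D : R →ₗ[k] R)).map ι.toLinearMap := by
    refine PowerSeries.le_of_order_eq _ _ ?_ c ?_ ?_
    · refine Submodule.map_mono ?_
      rintro _ ⟨r, hr, rfl⟩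
      exact hDm r hr
    · -- far out, solve `D y = w` by integrating `w / D`
      rintro _ ⟨w, hw, rfl⟩ hcw
      change (c : ℕ∞) ≤ (ι w).order at hcw
      have hw0 := (hm w).1 hw
      have hDx0 : ι (D x) ≠ 0 := by
        rw [Ne, ← PowerSeries.order_eq_top, hDx, PowerSeries.order_eq_top]
        exact hx
      obtain ⟨g, hg⟩ : ι (D x) ∣ ι w * PowerSeries.derivative k (ι x) := by
        refine PowerSeries.dvd_of_order_le_order hDx0 ?_
        rw [hDx, PowerSeries.order_mul, ← PowerSeries.order_derivative_add_one hx0, add_comm]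
        gcongr
        exact PowerSeries.one_le_order_iff_constCoeff_eq_zero.2 hw0
      obtain ⟨f, hf0, hf⟩ := PowerSeries.exists_derivative_eq g
      have hdx : PowerSeries.derivative k (ι x) ≠ 0 := by
        intro h
        have := PowerSeries.order_derivative_add_one hx0
        rw [h, PowerSeries.order_zero, top_add, eq_comm, PowerSeries.order_eq_top] at this
        exact hx this
      have hfo : (ι w).order = f.order := by
        have h := congrArg PowerSeries.order hg
        rw [PowerSeries.order_mul, PowerSeries.order_mul, hDx, ← hf] at h
        rw [← PowerSeries.order_derivative_add_one hf0]
        refine WithTop.add_right_cancel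
          (fun ht => hdx (PowerSeries.order_eq_top.1 ht)) (h.trans ?_)
        rw [← PowerSeries.order_derivative_add_one hx0]
        abel
      obtain ⟨y, rfl⟩ := hc f (hfo ▸ hcw)
      refine ⟨D y, ⟨y, (hm y).2 hf0, rfl⟩, ?_⟩
      refine mul_right_cancel₀ hdx ?_
      change ι (D y) * _ = ι w * _
      rw [hD y x, hf, hg]
    · rintro _ ⟨w, hw, rfl⟩ -
      exact ⟨ι (D w), ⟨D w, ⟨w, hw, rfl⟩, rfl⟩, hord w ((hm w).1 hw)⟩
  obtain ⟨_, ⟨y, -, rfl⟩, hy⟩ := key ⟨z, (hm z).2 hz, rfl⟩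
  exact ⟨y, hι hy⟩

/-- A subring of `k⟦t⟧` of finite colength that contains an element of order one is all of
`k⟦t⟧`, hence regular. -/
theorem isRegularLocalRing_of_order_eq_one [IsLocalRing R] [IsNoetherianRing R]
    (hdim : ringKrullDim R = 1) (ι : R →ₐ[k] k⟦X⟧) (hι : Function.Injective ι)
    (hloc : ∀ y, y ∈ IsLocalRing.maximalIdeal R → PowerSeries.constantCoeff (ι y) = 0)
    {c : ℕ} (hc : ∀ f : k⟦X⟧, (c : ℕ∞) ≤ f.order → f ∈ Set.range ι)
    {w : R} (hw : (ι w).order = 1) : IsRegularLocalRing R := by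
  have hsurj : ∀ f : k⟦X⟧, ∃ r, ι r = f := by
    have : (⊤ : Submodule k k⟦X⟧) ≤ LinearMap.range ι.toLinearMap := by
      refine PowerSeries.le_of_order_eq _ _ le_top c (fun f _ hf => hc f hf) fun f _ hf => ?_
      refine ⟨ι (w ^ f.order.toNat), ⟨_, rfl⟩, ?_⟩
      rw [map_pow, PowerSeries.order_pow, hw, nsmul_one, PowerSeries.coe_toNat_order hf]
    exact fun f => this trivial
  have hwne : ι w ≠ 0 := by
    intro h
    rw [h, PowerSeries.order_zero] at hw
    exact ENat.top_ne_one hw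
  have hspan : IsLocalRing.maximalIdeal R = Ideal.span {w} := by
    apply le_antisymm
    · intro z hz
      rw [Ideal.mem_span_singleton]
      obtain ⟨g, hg⟩ : ι w ∣ ι z := by
        refine PowerSeries.dvd_of_order_le_order hwne ?_
        rw [hw]
        exact PowerSeries.one_le_order_iff_constCoeff_eq_zero.2 (hloc z hz)
      obtain ⟨r, rfl⟩ := hsurj g
      exact ⟨r, hι (by rw [hg, map_mul])⟩
    · rw [Ideal.span_singleton_le_iff_mem, IsLocalRing.mem_maximalIdeal, mem_nonunits_iff]
      intro h
      rw [PowerSeries.order_zero_of_unit (h.map ι)] at hw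
      exact zero_ne_one hw
  refine IsRegularLocalRing.of_spanFinrank_maximalIdeal_le R ?_
  rw [hdim, hspan]
  have := Submodule.spanFinrank_span_le_ncard_of_finite (R := R) (Set.finite_singleton w)
  rw [Set.ncard_singleton] at this
  exact_mod_cast this

end Branch

/-! ### Derivations and the trace ideal of the differentials -/

section Trace

variable {k R : Type*} [Field k] [CommRing R] [Algebra k R] {n : ℕ}

/-- A linear form `α` on `Ω_R` gives a derivation `D` of `R`, with `D(π f) = α(df)`. The image of `α`
is the ideal generated by the values of `D` on the variables. -/
theorem exists_derivation_of_differentials (π : MvPowerSeries (Fin n) k →ₐ[k] R)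
    (hπ : Function.Surjective π) (α : UniversallyFiniteDifferentials π →ₗ[R] R) :
    ∃ D : Derivation k R R, (∀ r, D r ∈ LinearMap.range α) ∧
      LinearMap.range α = Ideal.span (Set.range fun i => D (π (MvPowerSeries.X i))) := by
  let β : (Fin n → R) →ₗ[R] R := α ∘ₗ (jacobianSubmodule π).mkQ
  have hβ : ∀ u, β u = ∑ i, u i * β (Pi.single i 1) := fun u => by
    conv_lhs => rw [LinearMap.pi_apply_eq_sum_univ β u]
    simp only [smul_eq_mul]
    refine Finset.sum_congr rfl fun i _ => ?_
    congr 2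
    ext j
    rw [Pi.single_apply]
    congr 1
    exact propext eq_comm
  choose d hd using fun i => hπ (β (Pi.single i 1))
  let d' : Derivation k (MvPowerSeries (Fin n) k) (MvPowerSeries (Fin n) k) :=
    ∑ i, d i • MvPowerSeries.pderiv k i
  have hsum : ∀ f, d' f = ∑ i, d i * MvPowerSeries.pderiv k i f := fun f => by
    have := congrFun (map_sum Derivation.coeFnAddMonoidHom
      (fun i => d i • MvPowerSeries.pderiv k i) Finset.univ) f
    rwa [Finset.sum_apply] at this
  have hd' : ∀ f, π (d' f) = β (jacobianRow π f) := fun f => by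
    rw [hβ, hsum, map_sum]
    refine Finset.sum_congr rfl fun i _ => ?_
    rw [map_mul, hd, mul_comm]
    rfl
  have hker : ∀ f, π f = 0 → π (d' f) = 0 := fun f hf => by
    rw [hd']
    have : jacobianRow π f ∈ jacobianSubmodule π := Submodule.subset_span ⟨f, hf, rfl⟩
    change α (Submodule.Quotient.mk _) = 0
    rw [(Submodule.Quotient.mk_eq_zero _).2 this, map_zero]
  let D : Derivation k R R := Derivation.liftOfSurjective hπ hker
  have hD : ∀ f, D (π f) = β (jacobianRow π f) := fun f => by
    rw [← hd']
    exact Derivation.liftOfSurjective_apply hπ hker f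
  have hrow : ∀ i, jacobianRow π (MvPowerSeries.X i) = Pi.single i 1 := fun i => by
    ext j
    obtain rfl | hij := eq_or_ne i j
    · rw [jacobianRow, MvPowerSeries.pderiv_X_self, map_one, Pi.single_eq_same]
    · rw [jacobianRow, MvPowerSeries.pderiv_X_of_ne hij, map_zero, Pi.single_eq_of_ne' hij]
  have hr : ∀ r, D r ∈ LinearMap.range α := fun r => by
    obtain ⟨f, rfl⟩ := hπ r
    rw [hD]
    exact ⟨_, rfl⟩
  refine ⟨D, hr, le_antisymm ?_ ?_⟩
  · rintro _ ⟨w, rfl⟩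
    obtain ⟨u, rfl⟩ := Submodule.Quotient.mk_surjective _ w
    change β u ∈ _
    rw [hβ]
    refine sum_mem fun i _ => Ideal.mul_mem_left _ _ (Ideal.subset_span ⟨i, ?_⟩)
    beta_reduce
    rw [hD, hrow]
  · rw [Ideal.span_le]
    rintro _ ⟨i, rfl⟩
    exact hr _

/-- A `k`-algebra map out of a power series ring is local, without any continuity assumption: if
`π f` had residue `a ≠ 0`, then the unit `f - a` would be sent to a non-unit. -/
theorem algHom_mem_maximalIdeal [IsLocalRing R]
    (hres : Function.Surjective (algebraMap k (IsLocalRing.ResidueField R)))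
    {σ : Type*} (π : MvPowerSeries σ k →ₐ[k] R) {f : MvPowerSeries σ k}
    (hf : MvPowerSeries.constantCoeff f = 0) : π f ∈ IsLocalRing.maximalIdeal R := by
  obtain ⟨a, ha⟩ := hres (IsLocalRing.residue R (π f))
  by_cases h0 : a = 0
  · rw [h0, map_zero] at ha
    exact (IsLocalRing.residue_eq_zero_iff _).1 ha.symm
  · have hu : IsUnit (f - MvPowerSeries.C a) := by
      rw [MvPowerSeries.isUnit_iff_constantCoeff]
      simpa [hf] using h0
    have hu' := hu.map π
    refine absurd ((IsLocalRing.residue_eq_zero_iff _).1 ?_ :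
      π (f - MvPowerSeries.C a) ∈ IsLocalRing.maximalIdeal R) fun h => h hu'
    have hC : π (MvPowerSeries.C a) = algebraMap k R a := π.commutes a
    rw [map_sub, map_sub, hC, ← ha, sub_eq_zero]
    rfl

theorem isQuasihomogeneous_iff_idealValuation_eq [CharZero k] [IsDomain R] [IsLocalRing R]
    [IsNoetherianRing R]
    (hres : Function.Surjective (algebraMap k (IsLocalRing.ResidueField R)))
    (hdim : ringKrullDim R = 1) (hnonreg : ¬ IsRegularLocalRing R)
    (π : MvPowerSeries (Fin n) k →ₐ[k] R) (hπ : Function.Surjective π)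
    (e : Normalization R ≃ₐ[k] k⟦X⟧) (φ : k⟦X⟧ →ₐ[k] R) (hφ : φ.toRingHom.IsIntegral)
    (hφi : Function.Injective φ) (hfin : Module.Finite R (Normalization R)) :
    IsQuasihomogeneous π ↔
      idealValuation e (traceIdeal R (UniversallyFiniteDifferentials π)) =
        idealValuation e (IsLocalRing.maximalIdeal R) := by
  let ι : R →ₐ[k] k⟦X⟧ := e.toAlgHom.comp (IsScalarTower.toAlgHom k R (Normalization R))
  have hι : Function.Injective ι :=
    e.injective.comp (FaithfulSMul.algebraMap_injective R (Normalization R))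
  have hv : ∀ y, orderValuation e y = (ι y).order := fun y => rfl
  have hunit : ∀ y, y ∉ IsLocalRing.maximalIdeal R → (ι y).order = 0 := fun y hy =>
    PowerSeries.order_zero_of_unit ((IsLocalRing.notMem_maximalIdeal.1 hy).map ι)
  have hloc : ∀ y ∈ IsLocalRing.maximalIdeal R, PowerSeries.constantCoeff (ι y) = 0 := by
    intro y hy
    by_contra h
    have h1 : IsUnit (ι y) := by
      rw [PowerSeries.isUnit_iff_constantCoeff]
      exact isUnit_iff_ne_zero.2 h
    have h2 : IsUnit (algebraMap R (Normalization R) y) := (isUnit_map_iff e _).1 h1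
    exact hy ((isUnit_map_iff (algebraMap R (Normalization R)) y).1 h2)
  have hφX : PowerSeries.constantCoeff (ι (φ PowerSeries.X)) = 0 :=
    hloc _ (algHom_mem_maximalIdeal hres (σ := Unit) φ (by exact PowerSeries.constantCoeff_X))
  obtain ⟨c, hc⟩ : ∃ c : ℕ, ∀ f : k⟦X⟧, (c : ℕ∞) ≤ f.order → f ∈ Set.range ι := by
    -- a common denominator of generators of the normalization lies in the conductor
    obtain ⟨r, hr, hrN⟩ := FractionalIdeal.isFractional_of_fg (S := nonZeroDivisors R)
      (Module.Finite.iff_fg.1 hfin : (Subalgebra.toSubmodule (integralClosure R (FractionRing R))).FG)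
    have hr0 : ι r ≠ 0 := by
      rw [Ne, map_eq_zero_iff _ hι]
      exact nonZeroDivisors.ne_zero hr
    refine ⟨(ι r).order.toNat, fun f hf => ?_⟩
    rw [PowerSeries.coe_toNat_order hr0] at hf
    obtain ⟨g, rfl⟩ := PowerSeries.dvd_of_order_le_order hr0 hf
    obtain ⟨s, hs⟩ := hrN (e.symm g : Normalization R) (e.symm g).2
    refine ⟨s, ?_⟩
    have : algebraMap R (Normalization R) s = algebraMap R (Normalization R) r * e.symm g :=
      Subtype.ext (by rw [Algebra.smul_def] at hs; exact hs)
    change e (algebraMap R (Normalization R) s) = e (algebraMap R (Normalization R) r) * g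
    rw [this, map_mul, e.apply_symm_apply]
  have hwr := Derivation.mul_derivative_eq_mul_derivative ι hι φ hφ hφi hφX
  set m := IsLocalRing.maximalIdeal R with hm
  set tr := traceIdeal R (UniversallyFiniteDifferentials π) with htr
  have hle : ∀ α : UniversallyFiniteDifferentials π →ₗ[R] R, LinearMap.range α ≤ tr := fun α =>
    le_iSup (fun α : UniversallyFiniteDifferentials π →ₗ[R] R => LinearMap.range α) α
  have hXm : ∀ i, π (MvPowerSeries.X i) ∈ m := fun i => algHom_mem_maximalIdeal hres π (by simp)
  constructor
  · rintro ⟨ψ, hψ⟩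
    congr 1
    apply le_antisymm
    · refine iSup_le fun α => ?_
      obtain ⟨D, -, hD⟩ := exists_derivation_of_differentials π hπ α
      rw [hD, Ideal.span_le]
      rintro _ ⟨i, rfl⟩
      by_contra h
      obtain ⟨w, hw⟩ := exists_order_eq_one_of_isUnit_derivation ι hι hc (hwr D)
        (IsLocalRing.notMem_maximalIdeal.1 h)
      exact hnonreg (isRegularLocalRing_of_order_eq_one hdim ι hι hloc hc hw)
    · intro y hy
      obtain ⟨w, hw⟩ := hψ ⟨y, hy⟩
      exact hle (m.subtype ∘ₗ ψ) ⟨w, congrArg Subtype.val hw⟩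
  · intro h
    have hlem : ∀ (J : Ideal R), ∀ y ∈ J, idealValuation e J ≤ (ι y).order := fun J y hy =>
      sInf_le ⟨y, hy, rfl⟩
    obtain ⟨z, hz, hzv⟩ : ∃ z ∈ m, (ι z).order = idealValuation e m :=
      csInf_mem (s := orderValuation e '' (m : Set R)) ⟨_, 0, m.zero_mem, rfl⟩
    have hz1 : 1 ≤ idealValuation e m := by
      rw [← hzv]
      exact PowerSeries.one_le_order_iff_constCoeff_eq_zero.2 (hloc z hz)
    have hfinite : idealValuation e m ≠ ⊤ := by
      intro ht
      have hbot : m = ⊥ := by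
        rw [eq_bot_iff]
        intro y hy
        have := hlem m y hy
        rw [ht, top_le_iff, PowerSeries.order_eq_top, map_eq_zero_iff _ hι] at this
        exact this
      have hfield := IsLocalRing.isField_iff_maximalIdeal_eq.2 hbot
      have := ringKrullDim_eq_zero_of_isField hfield
      rw [hdim] at this
      exact one_ne_zero this
    obtain ⟨E, hE⟩ : ∃ E : ℕ, idealValuation e m = E := ⟨_, (ENat.natCast_toNat hfinite).symm⟩
    obtain ⟨α, D, hDr, hD, i, hi⟩ : ∃ (α : UniversallyFiniteDifferentials π →ₗ[R] R)
        (D : Derivation k R R), (∀ r, D r ∈ LinearMap.range α) ∧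
        (LinearMap.range α = Ideal.span (Set.range fun i => D (π (MvPowerSeries.X i)))) ∧
        ∃ i, (ι (D (π (MvPowerSeries.X i)))).order ≤ E := by
      by_contra! hcon
      -- otherwise the trace ideal lies in the ideal `J` of elements of order greater than `E`
      let J : Ideal R := (Ideal.span {(PowerSeries.X : k⟦X⟧) ^ (E + 1)}).comap ι
      have hJ : ∀ y, y ∈ J ↔ ((E + 1 : ℕ) : ℕ∞) ≤ (ι y).order := fun y => by
        rw [Ideal.mem_comap, Ideal.mem_span_singleton, PowerSeries.X_pow_dvd_iff]
        exact ⟨fun h => PowerSeries.nat_le_order _ _ h, fun h i hi =>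
          PowerSeries.coeff_of_lt_order _ (lt_of_lt_of_le (by exact_mod_cast hi) h)⟩
      have htrJ : tr ≤ J := by
        refine iSup_le fun α => ?_
        obtain ⟨D, h1, h2⟩ := exists_derivation_of_differentials π hπ α
        rw [h2, Ideal.span_le]
        rintro _ ⟨i, rfl⟩
        rw [SetLike.mem_coe, hJ]
        push_cast
        exact Order.add_one_le_of_lt (hcon α D h1 h2 i)
      have : ((E + 1 : ℕ) : ℕ∞) ≤ idealValuation e tr := by
        refine le_sInf ?_
        rintro _ ⟨y, hy, rfl⟩
        exact (hJ y).1 (htrJ hy)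
      rw [h, hE] at this
      have : E + 1 ≤ E := by exact_mod_cast this
      omega
    set x := π (MvPowerSeries.X i) with hx
    have htrv : ∀ r, (E : ℕ∞) ≤ (ι (D r)).order := fun r => by
      rw [← hE, ← h]
      exact hlem _ _ (hle α (hDr r))
    have hDx : (ι (D x)).order = E := le_antisymm hi (htrv x)
    have hxv : (ι x).order = E := by
      have h1 := Derivation.order_add_order_eq ι (hwr D) (hloc x (hXm i)) (hloc z hz)
      rw [hDx, hzv, hE] at h1
      have h2 := hlem m x (hXm i)
      rw [hE] at h2
      refine le_antisymm ?_ h2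
      refine (ENat.add_le_add_iff_left (ENat.natCast_ne_top E)).1 ?_
      rw [h1]
      gcongr
      exact htrv z
    have hxne : ι x ≠ 0 := fun h0 => by
      rw [h0, PowerSeries.order_zero] at hxv
      exact ENat.natCast_ne_top E hxv.symm
    have hαm : ∀ w, α w ∈ m := fun w => by
      by_contra hw
      have h1 := hlem tr _ (hle α ⟨w, rfl⟩)
      rw [hunit _ hw, h] at h1
      exact absurd (hz1.trans h1) (by simp)
    refine ⟨α.codRestrict m hαm, fun ⟨y, hy⟩ => ?_⟩
    obtain ⟨u, rfl⟩ := Derivation.exists_eq_of_order_eq ι hι hc (hwr D) hxne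
      (hloc x (hXm i)) (hDx.trans hxv.symm) (hloc y hy)
    obtain ⟨w, hw⟩ := hDr u
    exact ⟨w, Subtype.ext hw⟩

end Trace

/-! ### Complete modules -/

theorem IsPrecomplete.pi {R M ι : Type*} [CommRing R] [AddCommGroup M] [Module R M] [Finite ι]
    (I : Ideal R) [IsPrecomplete I M] : IsPrecomplete I (ι → M) := by
  classical
  cases nonempty_fintype ι
  refine ⟨fun f hf => ?_⟩
  have hproj : ∀ (n : ℕ) (i : ι) (u : ι → M), u ∈ (I ^ n • ⊤ : Submodule R (ι → M)) →
      u i ∈ (I ^ n • ⊤ : Submodule R M) := fun n i u hu => by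
    have := Submodule.mem_map_of_mem (f := LinearMap.proj i) hu
    rw [Submodule.map_smul''] at this
    exact Submodule.smul_mono le_rfl le_top this
  have hsingle : ∀ (n : ℕ) (u : ι → M), (∀ i, u i ∈ (I ^ n • ⊤ : Submodule R M)) →
      u ∈ (I ^ n • ⊤ : Submodule R (ι → M)) := fun n u hu => by
    rw [← Finset.univ_sum_single u]
    refine sum_mem fun i _ => ?_
    have := Submodule.mem_map_of_mem (f := LinearMap.single R (fun _ : ι => M) i) (hu i)
    rw [Submodule.map_smul''] at this
    exact Submodule.smul_mono le_rfl le_top this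
  choose L hL using fun i => IsPrecomplete.prec (I := I) (M := M) inferInstance
    (f := fun n => f n i) fun {m n} hmn => by
      rw [SModEq.sub_mem]
      exact hproj m i _ ((SModEq.sub_mem).1 (hf hmn))
  refine ⟨L, fun n => ?_⟩
  rw [SModEq.sub_mem]
  exact hsingle n _ fun i => SModEq.sub_mem.1 (hL i n)

theorem IsPrecomplete.of_surjective {R M N : Type*} [CommRing R] [AddCommGroup M] [Module R M]
    [AddCommGroup N] [Module R N] (I : Ideal R) [IsPrecomplete I M] (f : M →ₗ[R] N)
    (hf : Function.Surjective f) : IsPrecomplete I N := by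
  rw [← AdicCompletion.of_surjective_iff]
  intro y
  obtain ⟨x, rfl⟩ := AdicCompletion.map_surjective I hf y
  obtain ⟨x, rfl⟩ := AdicCompletion.of_surjective I M x
  exact ⟨f x, rfl⟩

theorem IsPrecomplete.of_finite {R : Type*} (M : Type*) [CommRing R] [AddCommGroup M] [Module R M]
    (I : Ideal R) [IsPrecomplete I R] [Module.Finite R M] : IsPrecomplete I M := by
  obtain ⟨n, f, hf⟩ := Module.Finite.exists_fin' R M
  have := IsPrecomplete.pi (M := R) (ι := Fin n) I
  exact IsPrecomplete.of_surjective I f hf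

/-- Completeness for a power of an ideal gives completeness for the ideal. -/
theorem IsPrecomplete.of_pow {R : Type*} [CommRing R] (I : Ideal R) {e : ℕ} (he : e ≠ 0)
    [IsPrecomplete (I ^ e) R] : IsPrecomplete I R := by
  have hIe : ∀ n : ℕ, I ^ (e * n) ≤ I ^ n := fun n =>
    Ideal.pow_le_pow_right (Nat.le_mul_of_pos_left n (Nat.pos_of_ne_zero he))
  refine ⟨fun f hf => ?_⟩
  simp only [SModEq.sub_mem, smul_eq_mul, Ideal.mul_top] at hf ⊢
  obtain ⟨L, hL⟩ := IsPrecomplete.prec (I := I ^ e) (M := R) inferInstance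
    (f := fun n => f (e * n)) fun {m n} hmn => by
      rw [SModEq.sub_mem, smul_eq_mul, Ideal.mul_top, ← pow_mul]
      exact hf (Nat.mul_le_mul_left e hmn)
  simp only [SModEq.sub_mem, smul_eq_mul, Ideal.mul_top, ← pow_mul] at hL
  refine ⟨L, fun n => ?_⟩
  have := add_mem (hf (Nat.le_mul_of_pos_left n (Nat.pos_of_ne_zero he))) (hIe n (hL n))
  rwa [sub_add_sub_cancel] at this

/-- Nakayama's lemma over the complete ring `k⟦x⟧`: generators of `R / xR` over `k` lift to generators
of `R` over `k⟦x⟧`. -/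
theorem PowerSeries.finite_of_finite_quotient {k R : Type*} [Field k] [CommRing R] [IsLocalRing R]
    [IsNoetherianRing R] [Algebra k R] [Algebra k⟦X⟧ R] [IsScalarTower k k⟦X⟧ R]
    (hx : algebraMap k⟦X⟧ R PowerSeries.X ∈ IsLocalRing.maximalIdeal R)
    [Module.Finite k (R ⧸ Ideal.span {algebraMap k⟦X⟧ R PowerSeries.X})] :
    Module.Finite k⟦X⟧ R := by
  set x := algebraMap k⟦X⟧ R PowerSeries.X with hxdef
  set I : Ideal k⟦X⟧ := Ideal.span {PowerSeries.X}
  obtain ⟨n, g, hg⟩ := Module.Finite.exists_fin' k (R ⧸ Ideal.span {x})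
  choose s hs using fun i => Ideal.Quotient.mk_surjective (g (Pi.single i 1))
  have hpre := IsPrecomplete.pi (M := k⟦X⟧) (ι := Fin n) I
  have hmap : I.map (algebraMap k⟦X⟧ R) = Ideal.span {x} := by
    rw [Ideal.map_span, Set.image_singleton]
  have hhaus : IsHausdorff I R := by
    rw [← IsHausdorff.map_algebraMap_iff (S := R), hmap]
    refine IsHausdorff.of_isLocalRing _ _ fun h => ?_
    rw [Ideal.span_singleton_eq_top] at h
    exact hx h
  refine Module.Finite.of_surjective (Fintype.linearCombination k⟦X⟧ s)
    (surjective_of_mkQ_comp_surjective (I := I) fun q => ?_)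
  obtain ⟨y, rfl⟩ := Submodule.mkQ_surjective _ q
  obtain ⟨c, hc⟩ := hg (Ideal.Quotient.mk _ y)
  refine ⟨fun i => algebraMap k k⟦X⟧ (c i), ?_⟩
  rw [LinearMap.comp_apply, Submodule.mkQ_apply, Submodule.mkQ_apply, Submodule.Quotient.eq,
    Ideal.smul_top_eq_map, Submodule.restrictScalars_mem, hmap, ← Ideal.Quotient.eq, ← hc,
    LinearMap.pi_apply_eq_sum_univ g c, Fintype.linearCombination_apply, map_sum]
  refine Finset.sum_congr rfl fun i _ => ?_
  rw [algebraMap_smul, ← Ideal.Quotient.mkₐ_eq_mk k, map_smul, Ideal.Quotient.mkₐ_eq_mk, hs]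
  congr 2
  ext j
  rw [Pi.single_apply]
  congr 1
  exact propext eq_comm

theorem PowerSeries.algHom_injective {k R : Type*} [Field k] [CommRing R] [IsDomain R]
    [Algebra k R] (φ : k⟦X⟧ →ₐ[k] R) (hφ : φ PowerSeries.X ≠ 0) : Function.Injective φ := by
  rw [injective_iff_map_eq_zero]
  intro f hf
  by_contra h0
  obtain ⟨g, hg⟩ := PowerSeries.dvd_of_order_le_order (g := PowerSeries.X ^ f.order.toNat) h0
    (by rw [PowerSeries.order_X_pow, PowerSeries.coe_toNat_order h0])
  have := congrArg φ hg
  rw [map_mul, hf, zero_mul, map_pow] at this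
  exact hφ (eq_zero_of_pow_eq_zero this)

/-- A complete discrete valuation ring with a coefficient field is a power series ring. -/
theorem IsDiscreteValuationRing.nonempty_algEquiv_powerSeries {k B : Type*} [Field k] [CommRing B]
    [IsDomain B] [IsDiscreteValuationRing B] [Algebra k B]
    [IsAdicComplete (IsLocalRing.maximalIdeal B) B]
    (hres : Function.Surjective (algebraMap k (IsLocalRing.ResidueField B))) :
    Nonempty (B ≃ₐ[k] k⟦X⟧) := by
  obtain ⟨t, ht⟩ := IsDiscreteValuationRing.exists_irreducible B
  have hm := (IsDiscreteValuationRing.irreducible_iff_uniformizer t).1 ht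
  obtain ⟨φ, hφ⟩ := PowerSeries.exists_algHom_X_eq (k := k) (IsLocalRing.maximalIdeal B) t
    (by rw [hm]; exact Ideal.mem_span_singleton_self t)
  have hmap : (Ideal.span {(PowerSeries.X : k⟦X⟧)}).map φ.toRingHom =
      IsLocalRing.maximalIdeal B := by
    rw [Ideal.map_span, Set.image_singleton, hm]
    congr 2
  have hhaus : IsHausdorff ((Ideal.span {(PowerSeries.X : k⟦X⟧)}).map φ.toRingHom) B := by
    rw [hmap]
    infer_instance
  refine ⟨(AlgEquiv.ofBijective φ ⟨PowerSeries.algHom_injective φ (hφ ▸ ht.ne_zero),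
    surjective_of_mk_map_comp_surjective φ.toRingHom
      (I := Ideal.span {(PowerSeries.X : k⟦X⟧)}) fun q => ?_⟩).symm⟩
  obtain ⟨b, rfl⟩ := Ideal.Quotient.mk_surjective q
  obtain ⟨a, ha⟩ := hres (IsLocalRing.residue B b)
  refine ⟨algebraMap k k⟦X⟧ a, ?_⟩
  change Ideal.Quotient.mk _ (φ (algebraMap k k⟦X⟧ a)) = _
  rw [φ.commutes, Ideal.Quotient.eq, hmap, ← IsLocalRing.residue_eq_zero_iff, map_sub, ← ha,
    sub_eq_zero]
  rfl

/-! ### The presentation -/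

section Presentation

variable {k R : Type*} [Field k] [CommRing R] [IsLocalRing R] [IsNoetherianRing R] [Algebra k R]

theorem MvPowerSeries.mem_span_X_of_constantCoeff {σ k : Type*} [Finite σ] [CommRing k]
    {f : MvPowerSeries σ k} (hf : constantCoeff f = 0) :
    f ∈ Ideal.span (Set.range (X : σ → MvPowerSeries σ k)) := by
  have h := sub_truncTotal_mem 1 f
  have : truncTotal 1 f = 0 := by
    ext d
    rw [coeff_truncTotal_eq_ite]
    split_ifs with hd
    · have : d = 0 := by
        rw [← Finsupp.degree_eq_zero_iff]
        omega
      rw [this, coeff_zero_eq_constantCoeff_apply, hf, MvPolynomial.coeff_zero]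
    · rw [MvPolynomial.coeff_zero]
  rwa [this, MvPolynomial.coe_zero, sub_zero, pow_one] at h

theorem exists_minimal_presentation
    (hres : Function.Bijective (algebraMap k (IsLocalRing.ResidueField R)))
    [IsAdicComplete (IsLocalRing.maximalIdeal R) R] :
    ∃ π : MvPowerSeries (Fin (Module.finrank (IsLocalRing.ResidueField R)
        (IsLocalRing.CotangentSpace R))) k →ₐ[k] R, Function.Surjective π ∧
      RingHom.ker π ≤ Ideal.span (Set.range fun i => MvPowerSeries.X i) ^ 2 := by
  set m := IsLocalRing.maximalIdeal R with hm
  let b := Module.finBasis (IsLocalRing.ResidueField R) (IsLocalRing.CotangentSpace R)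
  choose x hx using fun i => m.toCotangent_surjective (b i)
  obtain ⟨π, hπ⟩ := MvPowerSeries.exists_algHom_X_eq (k := k) m (fun i => (x i : R))
    fun i => (x i).2
  have hspan : Ideal.span (Set.range fun i => (x i : R)) = m := by
    have h1 : Submodule.span R (Set.range x) = ⊤ := by
      rw [← IsLocalRing.CotangentSpace.span_image_eq_top_iff, ← Set.range_comp, ← b.span_eq]
      congr 2
      ext1 i
      exact hx i
    have h2 := congrArg (Submodule.map m.subtype) h1
    rw [Submodule.map_span, Submodule.map_subtype_top, ← Set.range_comp] at h2
    exact h2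
  have hmap : (Ideal.span (Set.range (MvPowerSeries.X (σ := Fin _) (R := k)))).map π.toRingHom =
      m := by
    rw [Ideal.map_span, ← Set.range_comp, ← hspan]
    congr 2
    ext1 i
    exact hπ i
  have hhaus : IsHausdorff ((Ideal.span (Set.range
      (MvPowerSeries.X (σ := Fin _) (R := k)))).map π.toRingHom) R := by
    rw [hmap]
    infer_instance
  refine ⟨π, surjective_of_mk_map_comp_surjective π.toRingHom
    (I := Ideal.span (Set.range (MvPowerSeries.X (σ := Fin _) (R := k)))) fun q => ?_, ?_⟩
  · obtain ⟨r, rfl⟩ := Ideal.Quotient.mk_surjective q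
    obtain ⟨a, ha⟩ := hres.2 (IsLocalRing.residue R r)
    refine ⟨algebraMap k _ a, ?_⟩
    change Ideal.Quotient.mk _ (π (algebraMap k _ a)) = _
    rw [π.commutes, Ideal.Quotient.eq, hmap, ← IsLocalRing.residue_eq_zero_iff, map_sub, ← ha,
      sub_eq_zero]
    rfl
  · have hconst : ∀ f, π f ∈ m → MvPowerSeries.constantCoeff f = 0 := fun f hf => by
      by_contra h
      exact hf (((MvPowerSeries.isUnit_iff_constantCoeff).2 (isUnit_iff_ne_zero.2 h)).map π)
    intro f hf
    have hf0 : π f = 0 := hf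
    have hfX := MvPowerSeries.mem_span_X_of_constantCoeff (hconst f (hf0 ▸ m.zero_mem))
    obtain ⟨g, hg⟩ := (Ideal.mem_span_range_iff_exists_fun).1 hfX
    have hsum : ∑ i, π (g i) • x i = 0 := by
      apply Subtype.ext
      have := congrArg π hg
      rw [hf0, map_sum] at this
      simpa [hπ] using this
    have hsum' : ∑ i, IsLocalRing.residue R (π (g i)) • b i = 0 := by
      have := congrArg m.toCotangent hsum
      rw [map_sum, map_zero] at this
      rw [← this]
      refine Finset.sum_congr rfl fun i _ => ?_
      rw [map_smul, hx]
      rfl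
    rw [← hg, pow_two]
    refine sum_mem fun i _ => Ideal.mul_mem_mul ?_ (Ideal.subset_span ⟨i, rfl⟩)
    refine MvPowerSeries.mem_span_X_of_constantCoeff (hconst _ ?_)
    rw [hm, ← IsLocalRing.residue_eq_zero_iff]
    exact Fintype.linearIndependent_iff.1 b.linearIndependent _ hsum' i

theorem two_le_finrank_cotangentSpace (hdim : ringKrullDim R = 1)
    (hnonreg : ¬ IsRegularLocalRing R) :
    2 ≤ Module.finrank (IsLocalRing.ResidueField R) (IsLocalRing.CotangentSpace R) := by
  rw [IsRegularLocalRing.iff_finrank_cotangentSpace, hdim] at hnonreg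
  have h1 := ringKrullDim_le_spanFinrank_maximalIdeal R
  rw [hdim, IsLocalRing.spanFinrank_maximalIdeal_eq_finrank_cotangentSpace] at h1
  have h1' : 1 ≤ Module.finrank (IsLocalRing.ResidueField R) (IsLocalRing.CotangentSpace R) := by
    exact_mod_cast h1
  have h2 : Module.finrank (IsLocalRing.ResidueField R) (IsLocalRing.CotangentSpace R) ≠ 1 :=
    fun h => hnonreg (by rw [h]; rfl)
  omega

/-- Modulo a parameter, a one-dimensional local ring with coefficient field `k` is
finite-dimensional over `k`. -/
theorem finite_quotient_span_singleton [IsDomain R] (hdim : ringKrullDim R = 1)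
    (hres : Function.Bijective (algebraMap k (IsLocalRing.ResidueField R)))
    [IsAdicComplete (IsLocalRing.maximalIdeal R) R]
    {x : R} (hx0 : x ≠ 0) : Module.Finite k (R ⧸ Ideal.span {x}) := by
  set m := IsLocalRing.maximalIdeal R with hm
  obtain ⟨π, hπ, -⟩ := exists_minimal_presentation hres
  have hdim1 : Ring.KrullDimLE 1 R := Ring.krullDimLE_iff.2 hdim.le
  obtain ⟨N, hN⟩ : ∃ N : ℕ, m ^ N ≤ Ideal.span {x} := by
    refine Ideal.exists_pow_le_of_le_radical_of_fg ?_ (IsNoetherian.noetherian m)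
    rw [Ideal.radical_eq_sInf]
    refine le_sInf fun J ⟨hJ1, hJ2⟩ => ?_
    have hJ : J ≠ ⊥ := by
      rintro rfl
      exact hx0 (hJ1 (Ideal.mem_span_singleton_self x))
    have hmax : J.IsMaximal := Ring.krullDimLE_one_iff_of_noZeroDivisors.1 hdim1 J hJ hJ2
    exact (IsLocalRing.eq_maximalIdeal hmax).ge
  have hpow : ∀ f ∈ Ideal.span (Set.range (MvPowerSeries.X (σ := Fin _) (R := k))) ^ N,
      π f ∈ m ^ N := fun f hf => by
    have h1 := Ideal.mem_map_of_mem π hf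
    rw [Ideal.map_pow] at h1
    refine Ideal.pow_right_mono ?_ N h1
    rw [Ideal.map_span, Ideal.span_le]
    rintro _ ⟨_, ⟨i, rfl⟩, rfl⟩
    exact algHom_mem_maximalIdeal hres.2 π (by simp)
  let ψ : MvPolynomial (Fin _) k →ₐ[k] R ⧸ Ideal.span {x} :=
    (Ideal.Quotient.mkₐ k _).comp (π.comp (MvPolynomial.coeToMvPowerSeries.algHom k))
  have hψ : Function.Surjective ψ := fun q => by
    obtain ⟨r, rfl⟩ := Ideal.Quotient.mk_surjective q
    obtain ⟨f, rfl⟩ := hπ r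
    refine ⟨MvPowerSeries.truncTotal N f, ?_⟩
    have := hN (hpow _ (MvPowerSeries.sub_truncTotal_mem N f))
    rw [map_sub, ← Ideal.Quotient.eq] at this
    exact this.symm
  have hft : Algebra.FiniteType k (R ⧸ Ideal.span {x}) :=
    Algebra.FiniteType.of_surjective ψ hψ
  rw [Module.finite_iff_krullDimLE_zero k, Ring.krullDimLE_iff]
  have := ringKrullDim_quotient_succ_le_of_nonZeroDivisor (mem_nonZeroDivisors_of_ne_zero hx0)
  rw [hdim] at this
  exact ENat.WithBot.add_le_add_one_right_iff.1 this

end Presentation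

/-! ### The normalization -/

/-- A domain that is Henselian at an ideal with Artinian quotient is local: idempotents lift, and a
domain has only the trivial ones. -/
theorem IsLocalRing.of_henselianRing_of_isArtinianRing {B : Type*} [CommRing B] [IsDomain B]
    (I : Ideal B) [HenselianRing B I] [IsArtinianRing (B ⧸ I)] : IsLocalRing B := by
  have hjac : I ≤ Ideal.jacobson ⊥ := HenselianRing.jac
  have hunit : ∀ a : B, IsUnit (Ideal.Quotient.mk I a) → IsUnit a := fun a ha =>
    (isLocalHom_of_le_jacobson_bot I hjac).map_nonunit a ha
  refine IsLocalRing.of_isUnit_or_isUnit_one_sub_self fun a => ?_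
  set q := Ideal.Quotient.mk I a with hq
  obtain ⟨n, y, hy⟩ := IsArtinian.exists_pow_succ_smul_dvd (M := B ⧸ I) q 1
  simp only [smul_eq_mul, mul_one, Nat.succ_eq_add_one] at hy
  -- `q ^ n * y ^ n` is the idempotent that cuts out the part on which `q` is invertible
  have hyj : ∀ j, q ^ (n + j) * y ^ j = q ^ n := by
    intro j
    induction j with
    | zero => simp
    | succ j ih =>
      calc q ^ (n + (j + 1)) * y ^ (j + 1) = q ^ j * y ^ j * (q ^ (n + 1) * y) := by ring
        _ = q ^ (n + j) * y ^ j := by rw [hy]; ring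
        _ = q ^ n := ih
  obtain ⟨b, hb⟩ := Ideal.Quotient.mk_surjective (q ^ n * y ^ n)
  have hidem : (q ^ n * y ^ n) * (q ^ n * y ^ n) = q ^ n * y ^ n := by
    calc (q ^ n * y ^ n) * (q ^ n * y ^ n) = (q ^ (n + n) * y ^ n) * y ^ n := by ring
      _ = q ^ n * y ^ n := by rw [hyj n]
  have hmonic : (Polynomial.X ^ 2 - Polynomial.X : Polynomial B).Monic :=
    Polynomial.monic_X_pow_sub (by rw [Polynomial.degree_X]; exact_mod_cast one_lt_two)
  have heval : (Polynomial.X ^ 2 - Polynomial.X : Polynomial B).eval b ∈ I := by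
    rw [← Ideal.Quotient.eq_zero_iff_mem, Polynomial.eval_sub, Polynomial.eval_pow,
      Polynomial.eval_X, map_sub, map_pow, hb, pow_two, hidem, sub_self]
  have hderiv : IsUnit (Ideal.Quotient.mk I
      ((Polynomial.X ^ 2 - Polynomial.X : Polynomial B).derivative.eval b)) := by
    have h1 : (Polynomial.X ^ 2 - Polynomial.X : Polynomial B).derivative.eval b = b + b - 1 := by
      simp
      ring
    rw [h1, map_sub, map_add, map_one, hb]
    exact IsUnit.of_mul_eq_one (q ^ n * y ^ n + q ^ n * y ^ n - 1)
      (by linear_combination 4 * hidem)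
  obtain ⟨f, hf, hfb⟩ := HenselianRing.is_henselian (I := I) _ hmonic b heval hderiv
  rw [← Ideal.Quotient.eq, hb] at hfb
  have hf' : f * (f - 1) = 0 := by
    have : f ^ 2 - f = 0 := by simpa [Polynomial.IsRoot] using hf
    linear_combination this
  rcases mul_eq_zero.1 hf' with h0 | h1
  · right
    refine hunit _ ?_
    rw [h0, map_zero] at hfb
    have hnil : q ^ n = 0 := by
      rw [← hyj n, pow_add, mul_assoc, ← hfb, mul_zero]
    rw [map_sub, map_one, ← hq]
    exact IsNilpotent.isUnit_one_sub ⟨n, hnil⟩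
  · left
    refine hunit _ ?_
    rw [sub_eq_zero.1 h1, map_one] at hfb
    have hu : IsUnit (q ^ n) := IsUnit.of_mul_eq_one _ hfb.symm
    rcases Nat.eq_zero_or_pos n with rfl | hn
    · refine IsUnit.of_mul_eq_one y ?_
      simpa using hy
    · exact (isUnit_pow_iff hn.ne').1 hu

/-- A Dedekind domain that is finite over `k⟦x⟧` is `k⟦t⟧`, if `x` is not a unit in it. -/
theorem IsDedekindDomain.nonempty_algEquiv_powerSeries {k N : Type*} [Field k] [IsAlgClosed k]
    [CommRing N] [IsDedekindDomain N] [Algebra k N] [Algebra k⟦X⟧ N]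
    [IsScalarTower k k⟦X⟧ N] [hfin : Module.Finite k⟦X⟧ N]
    (hx0 : algebraMap k⟦X⟧ N PowerSeries.X ≠ 0)
    (hxunit : ¬ IsUnit (algebraMap k⟦X⟧ N PowerSeries.X)) : Nonempty (N ≃ₐ[k] k⟦X⟧) := by
  classical
  have hded : IsDedekindDomain N := inferInstance
  set x : N := algebraMap k⟦X⟧ N PowerSeries.X with hxdef
  set I : Ideal k⟦X⟧ := Ideal.span {PowerSeries.X} with hI
  have hmap : I.map (algebraMap k⟦X⟧ N) = Ideal.span {x} := by
    rw [Ideal.map_span, Set.image_singleton]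
  have hne : Ideal.span {x} ≠ ⊤ := by rwa [Ne, Ideal.span_singleton_eq_top]
  have hpre : IsPrecomplete (Ideal.span {x}) N := by
    rw [← hmap, IsPrecomplete.map_algebraMap_iff]
    exact IsPrecomplete.of_finite N I
  have hhaus : IsHausdorff (Ideal.span {x}) N := IsHausdorff.of_isDomain _ hne
  have hcomp : IsAdicComplete (Ideal.span {x}) N := { }
  have hkill : ∀ f : k⟦X⟧, algebraMap k⟦X⟧ N f -
      algebraMap k N (PowerSeries.constantCoeff f) ∈ Ideal.span {x} := fun f => by
    rw [IsScalarTower.algebraMap_apply k k⟦X⟧ N, ← map_sub, ← hmap]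
    refine Ideal.mem_map_of_mem _ ?_
    rw [hI, Ideal.mem_span_singleton, PowerSeries.X_dvd_iff]
    simp
  have hqfin : Module.Finite k (N ⧸ Ideal.span {x}) := by
    obtain ⟨s, hs⟩ := hfin.fg_top
    refine ⟨s.image (Ideal.Quotient.mk (Ideal.span {x})), ?_⟩
    rw [eq_top_iff]
    intro q _
    obtain ⟨b, rfl⟩ := Ideal.Quotient.mk_surjective q
    have hb : b ∈ Submodule.span k⟦X⟧ (s : Set N) := hs ▸ trivial
    induction hb using Submodule.span_induction with
    | mem b hb => exact Submodule.subset_span (by simpa using ⟨b, hb, rfl⟩)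
    | zero => simp
    | add a b _ _ ha hb => rw [map_add]; exact add_mem (ha trivial) (hb trivial)
    | smul f b _ hb =>
      have : Ideal.Quotient.mk (Ideal.span {x}) (f • b) =
          PowerSeries.constantCoeff f • Ideal.Quotient.mk (Ideal.span {x}) b := by
        rw [Algebra.smul_def, Algebra.smul_def, map_mul]
        congr 1
        exact Ideal.Quotient.eq.2 (hkill f)
      rw [this]
      exact Submodule.smul_mem _ _ (hb trivial)
  have hart : IsArtinianRing (N ⧸ Ideal.span {x}) := IsArtinianRing.of_finite k _
  have hloc : IsLocalRing N := IsLocalRing.of_henselianRing_of_isArtinianRing (Ideal.span {x})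
  have hxm : x ∈ IsLocalRing.maximalIdeal N := hxunit
  have hnf : ¬ IsField N := fun h => hxunit (by
    let _ := h.toField
    exact isUnit_iff_ne_zero.2 hx0)
  have hdvr : IsDiscreteValuationRing N :=
    ((IsDiscreteValuationRing.TFAE N hnf).out 2 0).1 hded
  have hpows : ∀ (J : Ideal N) (_ : J ≠ ⊥), ∃ n : ℕ, J = IsLocalRing.maximalIdeal N ^ n :=
    ((IsDiscreteValuationRing.TFAE N hnf).out 0 6).1 hdvr
  obtain ⟨e, he⟩ := hpows (Ideal.span {x}) (by rwa [Ne, Ideal.span_singleton_eq_bot])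
  have he0 : e ≠ 0 := by
    rintro rfl
    rw [pow_zero, Ideal.one_eq_top] at he
    exact hne he
  rw [he] at hpre
  have hprem : IsPrecomplete (IsLocalRing.maximalIdeal N) N := IsPrecomplete.of_pow _ he0
  have hcompm : IsAdicComplete (IsLocalRing.maximalIdeal N) N := { }
  refine IsDiscreteValuationRing.nonempty_algEquiv_powerSeries ?_
  have hle : Ideal.span {x} ≤ IsLocalRing.maximalIdeal N := by
    rwa [Ideal.span_singleton_le_iff_mem]
  have : Module.Finite k (IsLocalRing.ResidueField N) :=
    Module.Finite.of_surjective (Ideal.Quotient.factorₐ k hle).toLinearMap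
      (Ideal.Quotient.factor_surjective hle)
  exact (IsAlgClosed.algebraMap_bijective_of_isIntegral
    (k := k) (K := IsLocalRing.ResidueField N)).2

section Normalization

variable {k R : Type*} [Field k] [CommRing R] [IsDomain R]

/-- Finiteness of the normalization, by separability over `k⟦x⟧`. -/
theorem Normalization.finite_isDedekindDomain [CharZero k] [Algebra k⟦X⟧ R]
    [FaithfulSMul k⟦X⟧ R] [Module.Finite k⟦X⟧ R] :
    Module.Finite k⟦X⟧ (Normalization R) ∧ IsDedekindDomain (Normalization R) := by
  let A := k⟦X⟧
  let K := FractionRing A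
  let L := FractionRing R
  have : CharZero A := charZero_of_injective_algebraMap (algebraMap k A).injective
  have : CharZero K := charZero_of_injective_algebraMap (IsFractionRing.injective A K)
  have hAL : FaithfulSMul A L := FaithfulSMul.trans A R L
  let _ : Algebra K L := FractionRing.liftAlgebra A L
  have : IsScalarTower A K L := FractionRing.isScalarTower_liftAlgebra A L
  have : FiniteDimensional K L := .of_isLocalization A R (nonZeroDivisors A)
  have hint : Algebra.IsIntegral A R := inferInstance
  have : IsIntegralClosure (Normalization R) A L :=
    { algebraMap_injective := Subtype.val_injective
      isIntegral_iff := fun {x} => by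
        constructor
        · intro hx
          exact ⟨⟨x, hx.tower_top⟩, rfl⟩
        · rintro ⟨y, rfl⟩
          exact isIntegral_trans _ y.2 }
  exact ⟨IsIntegralClosure.finite A K L (Normalization R),
    IsIntegralClosure.isDedekindDomain A K L (Normalization R)⟩

theorem Normalization.nonempty_algEquiv_powerSeries [Algebra k R] [IsAlgClosed k] [CharZero k]
    [IsLocalRing R]
    [Algebra k⟦X⟧ R] [IsScalarTower k k⟦X⟧ R]
    [FaithfulSMul k⟦X⟧ R] [Module.Finite k⟦X⟧ R]
    (hx : algebraMap k⟦X⟧ R PowerSeries.X ∈ IsLocalRing.maximalIdeal R) :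
    Nonempty (Normalization R ≃ₐ[k] k⟦X⟧) := by
  obtain ⟨hfin, hded⟩ := Normalization.finite_isDedekindDomain (k := k) (R := R)
  let N := Normalization R
  change Nonempty (N ≃ₐ[k] k⟦X⟧)
  have hded : IsDedekindDomain N := hded
  have hfin : Module.Finite k⟦X⟧ N := hfin
  have : IsScalarTower k k⟦X⟧ N := IsScalarTower.of_algebraMap_eq fun a => by
    rw [IsScalarTower.algebraMap_apply k⟦X⟧ R N, ← IsScalarTower.algebraMap_apply k k⟦X⟧ R,
      ← IsScalarTower.algebraMap_apply k R N]
  set x : N := algebraMap k⟦X⟧ N PowerSeries.X with hxdef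
  have hxR : x = algebraMap R N (algebraMap k⟦X⟧ R PowerSeries.X) :=
    IsScalarTower.algebraMap_apply k⟦X⟧ R N _
  have hxunit : ¬ IsUnit x := fun h => by
    rw [hxR, isUnit_map_iff (algebraMap R N)] at h
    exact hx h
  have hx0 : x ≠ 0 := by
    rw [hxR, Ne, map_eq_zero_iff _ (FaithfulSMul.algebraMap_injective R N),
      map_eq_zero_iff _ (FaithfulSMul.algebraMap_injective k⟦X⟧ R)]
    exact PowerSeries.X_ne_zero
  exact IsDedekindDomain.nonempty_algEquiv_powerSeries hx0 hxunit

end Normalization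

theorem theoremB {k R : Type*} [Field k] [IsAlgClosed k] [CharZero k]
    [CommRing R] [IsDomain R] [IsLocalRing R] [IsNoetherianRing R] [Algebra k R]
    (hres : Function.Bijective (algebraMap k (IsLocalRing.ResidueField R)))
    (hcomplete : IsAdicComplete (IsLocalRing.maximalIdeal R) R)
    (hdim : ringKrullDim R = 1)
    (hnonreg : ¬ IsRegularLocalRing R) :
    (∃ (n : ℕ) (π : MvPowerSeries (Fin n) k →ₐ[k] R), 2 ≤ n ∧ Function.Surjective π ∧
      RingHom.ker π ≤ Ideal.span (Set.range fun i : Fin n => MvPowerSeries.X i) ^ 2) ∧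
    Nonempty (Normalization R ≃ₐ[k] PowerSeries k) ∧
    ∀ (n : ℕ) (π : MvPowerSeries (Fin n) k →ₐ[k] R), Function.Surjective π →
      ∀ e : Normalization R ≃ₐ[k] PowerSeries k,
        IsQuasihomogeneous π ↔
          idealValuation e (traceIdeal R (UniversallyFiniteDifferentials π)) =
            idealValuation e (IsLocalRing.maximalIdeal R) := by
  obtain ⟨x, hxm, hx0⟩ : ∃ x ∈ IsLocalRing.maximalIdeal R, x ≠ 0 := by
    refine Submodule.exists_mem_ne_zero_of_ne_bot fun h => ?_
    have := ringKrullDim_eq_zero_of_isField (IsLocalRing.isField_iff_maximalIdeal_eq.2 h)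
    rw [hdim] at this
    exact one_ne_zero this
  obtain ⟨φ, rfl⟩ := PowerSeries.exists_algHom_X_eq (k := k) (IsLocalRing.maximalIdeal R) x hxm
  have hφ := PowerSeries.algHom_injective φ hx0
  let _ : Algebra k⟦X⟧ R := φ.toRingHom.toAlgebra
  have : IsScalarTower k k⟦X⟧ R := IsScalarTower.of_algebraMap_eq fun a => (φ.commutes a).symm
  have : FaithfulSMul k⟦X⟧ R := (faithfulSMul_iff_algebraMap_injective _ _).2 hφ
  have : Module.Finite k (R ⧸ Ideal.span {algebraMap k⟦X⟧ R PowerSeries.X}) :=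
    finite_quotient_span_singleton hdim hres hx0
  have hfin : Module.Finite k⟦X⟧ R := PowerSeries.finite_of_finite_quotient hxm
  refine ⟨?_, Normalization.nonempty_algEquiv_powerSeries hxm, fun n π hπ e => ?_⟩
  · obtain ⟨π, h1, h2⟩ := exists_minimal_presentation hres
    exact ⟨_, π, two_le_finrank_cotangentSpace hdim hnonreg, h1, h2⟩
  · have hfinN := (Normalization.finite_isDedekindDomain (k := k) (R := R)).1
    have hint : φ.toRingHom.IsIntegral := algebraMap_isIntegral_iff.2
      (inferInstance : Algebra.IsIntegral k⟦X⟧ R)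
    exact isQuasihomogeneous_iff_idealValuation_eq hres.2 hdim hnonreg π hπ e φ hint hφ
      (Module.Finite.of_restrictScalars_finite k⟦X⟧ R (Normalization R))
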